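/- **Setting.** Write $\mathbb N=\{1,2,\dots\}$ and $a\wedge b=\min\{a,b\}$. *Hölder ball.* For $\beta,r>0$ put $k=\lceil\beta\rceil-1$ and $\lambda=\beta-\lceil\beta\rceil+1$. Let $\mathcal B^\beta_r([0,1]^m)$ be the set of $f:[0,1]^m\to\mathbb R$ with continuous partial derivatives up to order $k$ on $[0,1]^m$ and $$\max_{\|\mathbf m\|_1\le k}\ \sup_{x}|D^{\mathbf m}f(x)|+\max_{\|\mathbf m\|_1=k}\ \sup_{x\ne z}\frac{|D^{\mathbf m}f(x)-D^{\mathbf m}f(z)|}{\|x-z\|_2^{\lambda}}\le r .$$ *Compositional class.* Let $\mathcal G^{\mathbf H}_m(d_*,\beta,r)$ be the set of functions $[0,1]^m\to\mathbb R$ of the form $x\mapsto g((x)_I)$ with $I\subset\{1,\dots,m\}$, $\#I=d_*$, $g\in\mathcal B^\beta_r([0,1]^{d_*})$, where $(x)_I$ lists the coordinates $x_i$, $i\in I$, in increasing order of $i$. Let $\mathcal G^{\mathbf{CH}}_d(q,K,d_*,\beta,r)$ be the set of compositions $h_q\circ\cdots\circ h_1\circ h_0$, where $h_0$ has domain $[0,1]^d$,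 $h_i$ has domain $[0,1]^K$ for $0<i\le q$, $h_i$ takes values in $[0,1]^K$ for $0\le i<q$, $h_q$ is real-valued, and $h_q$ and every coordinate function of $h_0,\dots,h_{q-1}$ belong to $\bigcup_{m\ge1}\mathcal G^{\mathbf H}_m(d_*,\beta,r)$. *Distributions.* For measurable $\eta:[0,1]^d\to[0,1]$ let $P_\eta$ be the probability measure on $[0,1]^d\times\{-1,1\}$ whose marginal on $[0,1]^d$ is Lebesgue measure and under which the label $1$ has conditional probability $\eta(x)$ given $x$. For $A\in[0,1)$ let $$\mathcal H=\mathcal H^{d,\beta,r}_{5,A,q,K,d_*}=\Big\{P_\eta:\ \eta\in\mathcal G^{\mathbf{CH}}_d(q,K,d_*,\beta,r),\ \eta([0,1]^d)\subset[0,1],\ |2\eta(x)-1|>A\text{ for almost every }x\in[0,1]^d\Big\}.$$ *Risk and estimators.* Let $\phi(t)=\log(1+e^{-t})$, let $\mathcal F_d$ be the set of Borel measurable functions $[0,1]^d\to\mathbb R$, and for $f\in\mathcal F_d$ let $$\mathcal E^\phi_P(f)=\int\phi(yf(x))\,dP(x,y)-\inf_{g\in\mathcal F_d}\int\phi(yg(x))\,dP(x,y)\in[0,\infty].$$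 An $\mathcal F_d$-valued statistic $\hat f_n$ of a sample of size $n$ is a map $\hat f_n:([0,1]^d\times\{-1,1\})^n\to\mathcal F_d$ such that $z\mapsto\mathcal E^\phi_P(\hat f_n(z))$ is measurable for every $P\in\mathcal H$ (in particular, any map for which $(z,x)\mapsto\hat f_n(z)(x)$ is Borel measurable); $\mathbf E_{P^{\otimes n}}[\mathcal E^\phi_P(\hat f_n)]\in[0,\infty]$ is its integral with respect to $P^{\otimes n}$. **Theorem 2.6.** Let $d_*\in\mathbb N$, $\beta\in(0,\infty)$, $r\in(0,\infty)$ and $q\in\mathbb N\cup\{0\}$. There exists a constant $c_0\in(0,\infty)$, depending only on $(d_*,\beta,r,q)$, such that for all $n,d,K\in\mathbb N$ and $A\in[0,1)$ with $d_*\le d$, with $d_*\le K$ in case $q\ge1$, and with $$n>\Big|\frac{7}{1-A}\Big|^{\frac{d_*+\beta(1\wedge\beta)^q}{\beta(1\wedge\beta)^q}},$$ one has $$\inf_{\hat f_n}\ \sup_{P\in\mathcal H^{d,\beta,r}_{5,A,q,K,d_*}}\mathbf E_{P^{\otimes n}}\big[\mathcal E^\phi_P(\hat f_n)\big]\ \ge\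 c_0\,n^{-\frac{\beta(1\wedge\beta)^q}{d_*+\beta(1\wedge\beta)^q}},$$ where the infimum is over all $\mathcal F_d$-valued statistics $\hat f_n$ of a sample of size $n$. -/

import Mathlib

open MeasureTheory
open scoped ENNReal unitInterval

noncomputable section

namespace LogisticMinimax

/-! ### The sample space -/

/-- The cube `[0,1]^d`; it carries its Borel sigma-algebra, and its `volume` is Lebesgue measure. -/
abbrev Cube (d : ℕ) : Type := Fin d → I

/-- The set of labels `{-1, 1}`. -/
abbrev Label : Type := ({-1, 1} : Set ℝ)

/-- The label `1`. -/
def Label.pos : Label := ⟨1, by simp⟩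

/-- The label `-1`. -/
def Label.neg : Label := ⟨-1, by simp⟩

/-- The inclusion of `[0,1]^d` into `ℝ^d`. -/
def Cube.toReal {d : ℕ} (x : Cube d) : Fin d → ℝ := fun i => (x i : ℝ)

/-- The cube `[0,1]^d` as a subset of `ℝ^d`. -/
def cubeSet (d : ℕ) : Set (Fin d → ℝ) := Set.Icc 0 1

/-! ### Hölder balls on the cube -/

/-- The partial derivative `∂_{j 0} ∂_{j 1} ⋯ ∂_{j (l-1)} F` at the point `x`, taken within the closed
cube (hence one-sided at the boundary). As `j` ranges over all `l`-tuples of coordinates, this ranges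
over all derivatives `D^m F` with a multi-index `m` of length `l`. -/
def partialDeriv {d l : ℕ} (F : (Fin d → ℝ) → ℝ) (j : Fin l → Fin d) (x : Fin d → ℝ) : ℝ :=
  iteratedFDerivWithin ℝ l F (cubeSet d) x (fun t => Pi.single (j t) 1)

/-- The Hölder seminorm of order `lam` of a function on the cube, with respect to the Euclidean
distance, as an extended nonnegative number. -/
def holderSeminorm {d : ℕ} (lam : ℝ) (G : (Fin d → ℝ) → ℝ) : ℝ≥0∞ :=
  ⨆ (x ∈ cubeSet d) (z ∈ cubeSet d) (_ : x ≠ z),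
    ENNReal.ofReal (|G x - G z| / ‖(WithLp.toLp 2 (x - z) : EuclideanSpace ℝ (Fin d))‖ ^ lam)

/-- The norm of the Hölder space `C^{k,lam}([0,1]^d)`: the maximum of the sup norms of the partial
derivatives of order at most `k`, plus the maximum of the Hölder-`lam` seminorms of the partial
derivatives of order exactly `k`. -/
def holderNorm {d : ℕ} (k : ℕ) (lam : ℝ) (F : (Fin d → ℝ) → ℝ) : ℝ≥0∞ :=
  (⨆ (l : ℕ) (_ : l ≤ k) (j : Fin l → Fin d) (x ∈ cubeSet d), ENNReal.ofReal |partialDeriv F j x|)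
    + ⨆ j : Fin k → Fin d, holderSeminorm lam (partialDeriv F j)

/-- The closed ball of radius `r` about the origin of the Hölder space of order `β > 0` on `[0,1]^d`,
that is, of `C^{k,lam}([0,1]^d)` with `k = ⌈β⌉ - 1` and `lam = β - ⌈β⌉ + 1`. The function `F` is only
used to speak of derivatives: all conditions on it depend only on its values on the cube. -/
def holderBall (d : ℕ) (β r : ℝ) : Set (Cube d → ℝ) :=
  {f | ∃ F : (Fin d → ℝ) → ℝ, (∀ x : Cube d, F x.toReal = f x) ∧
    ContDiffOn ℝ ((⌈β⌉₊ - 1 : ℕ) : WithTop ℕ∞) F (cubeSet d) ∧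
    holderNorm (⌈β⌉₊ - 1) (β - ⌈β⌉₊ + 1) F ≤ ENNReal.ofReal r}

/-! ### The compositional Hölder class -/

/-- Functions on `[0,1]^d` of the form `x ↦ g ((x)_I)` with `g` in the Hölder ball on `[0,1]^dstar`
and `I` a set of exactly `dstar` coordinates; `e` is the increasing enumeration of `I`. -/
def sparseHolder (d dstar : ℕ) (β r : ℝ) : Set (Cube d → ℝ) :=
  {f | ∃ (e : Fin dstar ↪o Fin d), ∃ g ∈ holderBall dstar β r, ∀ x : Cube d, f x = g (x ∘ e)}

/-- `compHolder K dstar β r q d` is the set of all `h_q ∘ ⋯ ∘ h_1 ∘ h_0` with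
`h_0 : [0,1]^d → [0,1]^K`, `h_i : [0,1]^K → [0,1]^K` for `0 < i < q` and `h_q : [0,1]^K → ℝ`
(simply `h_0 : [0,1]^d → ℝ` if `q = 0`), all of whose component functions are in `sparseHolder`.
The recursion splits off the innermost function `h_0`. -/
def compHolder (K dstar : ℕ) (β r : ℝ) : ℕ → (d : ℕ) → Set (Cube d → ℝ)
  | 0, d => sparseHolder d dstar β r
  | q + 1, d => {f | ∃ h : Cube d → Cube K,
      (∀ j : Fin K, (fun x => (h x j : ℝ)) ∈ sparseHolder d dstar β r) ∧
      ∃ g ∈ compHolder K dstar β r q K, f = g ∘ h}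

/-! ### The class of distributions -/

/-- The probability measure on `{-1, 1}` giving mass `a ∈ [0,1]` to `1` and mass `1 - a` to `-1`. -/
def labelMeasure (a : ℝ) : Measure Label :=
  ENNReal.ofReal a • Measure.dirac Label.pos + ENNReal.ofReal (1 - a) • Measure.dirac Label.neg

/-- The distribution on `[0,1]^d × {-1, 1}` whose first marginal is Lebesgue measure and whose
conditional probability function is `η`: a set `S` has mass `∫ labelMeasure (η x) {y | (x, y) ∈ S} dx`. -/
def jointMeasure {d : ℕ} (η : Cube d → ℝ) : Measure (Cube d × Label) :=
  (volume : Measure (Cube d)).bind fun x => (labelMeasure (η x)).map fun y => (x, y)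

/-- The distributions `jointMeasure η` with `η` a `[0,1]`-valued function in the compositional Hölder
class such that `|2 η - 1| > A` almost everywhere. -/
def distClass (d : ℕ) (β r A : ℝ) (q K dstar : ℕ) : Set (Measure (Cube d × Label)) :=
  {P | ∃ η ∈ compHolder K dstar β r q d, (∀ x, η x ∈ Set.Icc (0 : ℝ) 1) ∧
    (volume : Measure (Cube d)) {x | |2 * η x - 1| ∈ Set.Icc 0 A} = 0 ∧ P = jointMeasure η}

/-! ### Logistic risk and minimax risk -/

/-- The logistic loss. -/
def logisticLoss (t : ℝ) : ℝ := Real.log (1 + Real.exp (-t))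

/-- The Borel measurable functions `[0,1]^d → ℝ`. -/
abbrev MeasFun (d : ℕ) : Type := {f : Cube d → ℝ // Measurable f}

/-- The logistic risk of `f` under `P`, an element of `[0,∞]`. -/
def risk {d : ℕ} (P : Measure (Cube d × Label)) (f : MeasFun d) : ℝ≥0∞ :=
  ∫⁻ p, ENNReal.ofReal (logisticLoss ((p.2 : ℝ) * f.1 p.1)) ∂P

/-- The excess logistic risk of `f` under `P`, an element of `[0,∞]`. -/
def excessRisk {d : ℕ} (P : Measure (Cube d × Label)) (f : MeasFun d) : ℝ≥0∞ :=
  risk P f - ⨅ g : MeasFun d, risk P g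

/-- Estimators from a sample of size `n`, for a class `H` of distributions: maps from samples to
measurable functions on `[0,1]^d` whose excess risk under every `P ∈ H` is a measurable function of the
sample, so that the expected excess risk is defined. These are the maps that are measurable for some
sigma-algebra on `MeasFun d` which makes the functionals `excessRisk P`, `P ∈ H`, measurable. -/
def Estimator (d n : ℕ) (H : Set (Measure (Cube d × Label))) : Type :=
  {T : (Fin n → Cube d × Label) → MeasFun d // ∀ P ∈ H, Measurable fun z => excessRisk P (T z)}

/-- The minimax risk: the infimum over all estimators `T` of the supremum over all `P ∈ H` of the
expectation of the excess logistic risk of `T` when the sample has the distribution `P^{⊗ n}`. -/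
def minimaxRisk (d n : ℕ) (H : Set (Measure (Cube d × Label))) : ℝ≥0∞ :=
  ⨅ T : Estimator d n H, ⨆ P ∈ H, ∫⁻ z, excessRisk P (T.1 z) ∂(Measure.pi fun _ : Fin n => P)

end LogisticMinimax

end

/-!
The lower bound is proved by Assouad's method with hypotheses that sit at the edge of the noise
condition. Write `s = β (1 ∧ β)^q`. Split the `dstar` active coordinates into a grid of `M ^ dstar`
cells and let the conditional probability `η τ` be a bump of height `ε` of order `M ^ (-s)` on the
cells selected by `τ` and `0` on the others. Such functions lie in the class: a sum of bumps of height
`M ^ (-β)` lies in a fixed Hölder ball of order `β` (`rescaled_mem_holderBall`,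
`exists_bound_iteratedFDeriv_bumpSum`), and composing it with `q` copies of a multiple of
`t ↦ t ^ (1 ∧ β)` turns the height into a multiple of `M ^ (-s)` (`iterate_comp_mem_compHolder`). As
`η τ` is at most `ε`, the margin condition only asks that `ε < (1 - A) / 2`.

Of two hypotheses that differ in a single cell, the one with the bump is dominated by the other one
away from the points of the cell with label `1` (`jointMeasure_restrict_le`). A sample avoids these
points with probability at least `1 / 2` if `n ε M ^ (-dstar) ≤ 1 / 2` (`half_le_pi_restrict`), so the
two sample distributions have a common part of mass at least `1 / 2`. On the other hand no score is
good both for the label probability `ε` and for the label probability `0`: the excess logistic losses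
add up to at least `ε / 4` (`exists_condLoss_separation`). That this is linear in `ε`, not quadratic,
gives the exponent its denominator `dstar + s`. Summing over the cells (`assouad`,
`le_minimaxRisk_of_hypercube`) bounds the minimax risk below by a multiple of `ε`, and `M` is taken
of the smallest order that makes `n ε M ^ (-dstar)` small, which is `n ^ (1 / (dstar + s))`.

Estimators are only assumed to have measurable excess risks, so the losses on the single cells need not
be measurable functions of the sample. They are therefore compared pointwise under the densities
of the sample distributions, and integrated only after they have been bounded below by a constant.
-/

namespace LogisticMinimax

/-! ### Assouad's lemma -/

theorem pi_mono_measure {ι : Type*} [Fintype ι] {α : ι → Type*} [∀ i, MeasurableSpace (α i)]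
    {μ ν : ∀ i, Measure (α i)} [∀ i, SigmaFinite (μ i)] (h : ∀ i, μ i ≤ ν i) :
    Measure.pi μ ≤ Measure.pi ν := by
  rw [Measure.le_iff]
  intro s hs
  rw [Measure.pi, Measure.pi, toMeasure_apply _ _ hs, toMeasure_apply _ _ hs]
  refine OuterMeasure.le_pi.2 (fun t _ => ?_) s
  refine (OuterMeasure.pi_pi_le _ t).trans ?_
  exact Finset.prod_le_prod' fun i _ => h i (t i)

theorem rnDeriv_mono_ae {Ω : Type*} [MeasurableSpace Ω] {ν Q m : Measure Ω} [IsFiniteMeasure m]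
    [IsFiniteMeasure ν] [IsFiniteMeasure Q] (hQ : Q ≪ m) (h : ν ≤ Q) :
    ν.rnDeriv m ≤ᵐ[m] Q.rnDeriv m := by
  refine ae_le_of_forall_setLIntegral_le_of_sigmaFinite (Measure.measurable_rnDeriv _ _) ?_
  intro s hs _
  rw [Measure.setLIntegral_rnDeriv (h.absolutelyContinuous.trans hQ),
    Measure.setLIntegral_rnDeriv hQ]
  exact h s

/-- **Assouad's lemma**, for a risk `R` that dominates a sum of local losses `r`, one for each
coordinate of the hypercube. No measurability is asked of the local losses: they are compared
pointwise, under densities with respect to one dominating measure. -/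
theorem assouad {Ω ι : Type*} [MeasurableSpace Ω] [Fintype ι] [DecidableEq ι]
    (Q : (ι → Bool) → Measure Ω) [∀ τ, IsFiniteMeasure (Q τ)]
    (ν : ι → (ι → Bool) → Measure Ω)
    (R : (ι → Bool) → Ω → ℝ≥0∞) (hR : ∀ τ, Measurable (R τ))
    (r : ι → Bool → Ω → ℝ≥0∞) (hr : ∀ τ z, ∑ j, r j (τ j) z ≤ R τ z)
    (Δ κ : ℝ≥0∞) (hΔ : ∀ j z, Δ ≤ r j true z + r j false z)
    (hν : ∀ j τ b, ν j τ ≤ Q (Function.update τ j b)) (hκ : ∀ j τ, κ ≤ ν j τ Set.univ) :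
    Fintype.card ι * (Δ * κ) ≤ 2 * ⨆ τ, ∫⁻ z, R τ z ∂(Q τ) := by
  set m : Measure Ω := ∑ τ, Q τ with hm
  have hQm : ∀ τ, Q τ ≤ m := fun τ => by
    rw [hm, Measure.le_iff]
    intro s _
    rw [Measure.finsetSum_apply]
    exact Finset.single_le_sum (f := fun ω => Q ω s) (fun _ _ => zero_le) (Finset.mem_univ τ)
  have hQac : ∀ τ, Q τ ≪ m := fun τ => (hQm τ).absolutelyContinuous
  have hνfin : ∀ j τ, IsFiniteMeasure (ν j τ) := fun j τ =>
    isFiniteMeasure_of_le _ (hν j τ true)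
  set p : (ι → Bool) → Ω → ℝ≥0∞ := fun τ => (Q τ).rnDeriv m with hp
  have hpm : ∀ τ, Measurable (p τ) := fun τ => Measure.measurable_rnDeriv _ _
  have hRint : ∀ τ, ∫⁻ z, R τ z ∂(Q τ) = ∫⁻ z, p τ z * R τ z ∂m := fun τ =>
    (lintegral_rnDeriv_mul (hQac τ) (hR τ).aemeasurable).symm
  -- flipping one coordinate pairs each vertex with a neighbour under which `r j` takes its other value
  have hflip : ∀ j : ι, ∀ F : (ι → Bool) → ℝ≥0∞,
      ∑ τ, F (Function.update τ j (!τ j)) = ∑ τ, F τ := by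
    intro j F
    have hinv : Function.Involutive fun τ : ι → Bool => Function.update τ j (!τ j) := by
      intro τ; simp
    exact Equiv.sum_comp hinv.toPerm F
  have hpoint : ∀ᵐ z ∂m, ∑ j, ∑ τ, Δ * (ν j τ).rnDeriv m z ≤ 2 * ∑ τ, p τ z * R τ z := by
    have hae : ∀ᵐ z ∂m, ∀ j τ b, (ν j τ).rnDeriv m z ≤ p (Function.update τ j b) z := by
      simp only [ae_all_iff]
      exact fun j τ b => rnDeriv_mono_ae (hQac _) (hν j τ b)
    filter_upwards [hae] with z hz
    calc ∑ j, ∑ τ, Δ * (ν j τ).rnDeriv m z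
        ≤ ∑ j, ∑ τ, (p τ z * r j (τ j) z
            + p (Function.update τ j (!τ j)) z * r j (!τ j) z) := by
          refine Finset.sum_le_sum fun j _ => Finset.sum_le_sum fun τ _ => ?_
          have h1 : (ν j τ).rnDeriv m z ≤ p τ z := by
            simpa using hz j τ (τ j)
          have h2 := hz j τ (!τ j)
          have h3 : Δ ≤ r j (τ j) z + r j (!τ j) z := by
            cases τ j
            · simpa [add_comm] using hΔ j z
            · simpa using hΔ j z
          calc Δ * (ν j τ).rnDeriv m z
              ≤ (r j (τ j) z + r j (!τ j) z) * (ν j τ).rnDeriv m z := by gcongr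
            _ = (ν j τ).rnDeriv m z * r j (τ j) z + (ν j τ).rnDeriv m z * r j (!τ j) z := by ring
            _ ≤ _ := by gcongr
      _ = ∑ j, 2 * ∑ τ, p τ z * r j (τ j) z := by
          refine Finset.sum_congr rfl fun j _ => ?_
          have := hflip j (fun τ => p τ z * r j (τ j) z)
          simp only [Function.update_self] at this
          rw [Finset.sum_add_distrib, this, two_mul]
      _ = 2 * ∑ τ, p τ z * ∑ j, r j (τ j) z := by
          rw [← Finset.mul_sum, Finset.sum_comm]
          simp only [Finset.mul_sum]
      _ ≤ _ := by
          gcongr with τ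
          exact hr τ z
  have hint := lintegral_mono_ae hpoint
  have hlhs : ∫⁻ z, ∑ j, ∑ τ, Δ * (ν j τ).rnDeriv m z ∂m = ∑ j, ∑ τ, Δ * ν j τ Set.univ := by
    have hme : ∀ j τ, Measurable fun z => Δ * (ν j τ).rnDeriv m z := fun j τ =>
      (Measure.measurable_rnDeriv _ _).const_mul _
    rw [lintegral_finsetSum _ fun j _ => Finset.measurable_sum _ fun τ _ => hme j τ]
    refine Finset.sum_congr rfl fun j _ => ?_
    rw [lintegral_finsetSum _ fun τ _ => hme j τ]
    refine Finset.sum_congr rfl fun τ _ => ?_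
    rw [lintegral_const_mul _ (Measure.measurable_rnDeriv _ _),
      Measure.lintegral_rnDeriv (((hν j τ true).trans (hQm _)).absolutelyContinuous)]
  have hrhs : ∫⁻ z, 2 * ∑ τ, p τ z * R τ z ∂m = 2 * ∑ τ, ∫⁻ z, R τ z ∂(Q τ) := by
    have hme : ∀ τ, Measurable fun z => p τ z * R τ z := fun τ => (hpm τ).mul (hR τ)
    rw [lintegral_const_mul _ (Finset.measurable_sum _ fun τ _ => hme τ),
      lintegral_finsetSum _ fun τ _ => hme τ]
    simp only [hRint]
  rw [hlhs, hrhs] at hint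
  set V : ℝ≥0∞ := (Fintype.card (ι → Bool) : ℝ≥0∞) with hV
  have hV0 : V ≠ 0 := by rw [hV]; exact_mod_cast Fintype.card_ne_zero
  have hVt : V ≠ ∞ := by rw [hV]; exact ENNReal.natCast_ne_top _
  have hlow : V * (Fintype.card ι * (Δ * κ)) ≤ ∑ j, ∑ τ, Δ * ν j τ Set.univ := by
    calc V * (Fintype.card ι * (Δ * κ)) = ∑ _j : ι, ∑ _τ : ι → Bool, Δ * κ := by
          simp only [Finset.sum_const, Finset.card_univ, nsmul_eq_mul]
          ring
      _ ≤ _ := by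
          gcongr with j _ τ
          exact hκ j τ
  have hup : 2 * ∑ τ, ∫⁻ z, R τ z ∂(Q τ) ≤ V * (2 * ⨆ τ, ∫⁻ z, R τ z ∂(Q τ)) := by
    calc 2 * ∑ τ, ∫⁻ z, R τ z ∂(Q τ)
        ≤ 2 * ∑ _τ : ι → Bool, ⨆ τ, ∫⁻ z, R τ z ∂(Q τ) := by
          gcongr with ω
          exact le_iSup (fun τ => ∫⁻ z, R τ z ∂(Q τ)) ω
      _ = _ := by
          simp only [Finset.sum_const, Finset.card_univ, nsmul_eq_mul]
          ring
  exact (ENNReal.mul_le_mul_iff_right hV0 hVt).1 (hlow.trans (hint.trans hup))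

/-! ### The joint distribution of a point and its label -/

theorem labelMeasure_map {X : Type*} [MeasurableSpace X] (a : ℝ) (x : X) :
    (labelMeasure a).map (fun y => (x, y)) = ENNReal.ofReal a • Measure.dirac (x, Label.pos)
      + ENNReal.ofReal (1 - a) • Measure.dirac (x, Label.neg) := by
  have hm : Measurable fun y : Label => (x, y) := measurable_prodMk_left
  rw [labelMeasure, Measure.map_add _ _ hm, Measure.map_smul, Measure.map_smul,
    Measure.map_dirac' hm, Measure.map_dirac' hm]

theorem measurable_labelMeasure_map {d : ℕ} {η : Cube d → ℝ} (hη : Measurable η) :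
    Measurable fun x : Cube d => (labelMeasure (η x)).map fun y => (x, y) := by
  refine Measure.measurable_of_measurable_coe _ fun s hs => ?_
  simp only [labelMeasure_map, Measure.add_apply, Measure.smul_apply, smul_eq_mul,
    Measure.dirac_apply' _ hs]
  have h1 : ∀ l : Label, Measurable fun x : Cube d => s.indicator (1 : Cube d × Label → ℝ≥0∞) (x, l) :=
    fun l => (measurable_one.indicator hs).comp measurable_prodMk_right
  exact (hη.ennreal_ofReal.mul (h1 _)).add ((hη.const_sub 1).ennreal_ofReal.mul (h1 _))

theorem lintegral_jointMeasure {d : ℕ} {η : Cube d → ℝ} (hη : Measurable η)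
    {f : Cube d × Label → ℝ≥0∞} (hf : Measurable f) :
    ∫⁻ p, f p ∂(jointMeasure η) = ∫⁻ x, (ENNReal.ofReal (η x) * f (x, Label.pos)
      + ENNReal.ofReal (1 - η x) * f (x, Label.neg)) := by
  rw [jointMeasure, Measure.lintegral_bind (measurable_labelMeasure_map hη).aemeasurable
    hf.aemeasurable]
  refine lintegral_congr fun x => ?_
  rw [labelMeasure_map, lintegral_add_measure, lintegral_smul_measure, lintegral_smul_measure,
    lintegral_dirac' _ hf, lintegral_dirac' _ hf, smul_eq_mul, smul_eq_mul]

theorem jointMeasure_apply {d : ℕ} {η : Cube d → ℝ} (hη : Measurable η)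
    {s : Set (Cube d × Label)} (hs : MeasurableSet s) :
    jointMeasure η s = ∫⁻ x, (ENNReal.ofReal (η x) * s.indicator 1 (x, Label.pos)
      + ENNReal.ofReal (1 - η x) * s.indicator 1 (x, Label.neg)) := by
  rw [← lintegral_jointMeasure hη (measurable_one.indicator hs), lintegral_indicator_one hs]

theorem isProbabilityMeasure_jointMeasure {d : ℕ} {η : Cube d → ℝ} (hη : Measurable η)
    (h01 : ∀ x, η x ∈ Set.Icc (0 : ℝ) 1) : IsProbabilityMeasure (jointMeasure η) := by
  constructor
  rw [jointMeasure_apply hη MeasurableSet.univ]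
  have : ∀ x, ENNReal.ofReal (η x) * Set.univ.indicator (1 : Cube d × Label → ℝ≥0∞) (x, Label.pos)
      + ENNReal.ofReal (1 - η x) * Set.univ.indicator 1 (x, Label.neg) = 1 := by
    intro x
    simp only [Set.indicator_univ, Pi.one_apply, mul_one]
    rw [← ENNReal.ofReal_add (h01 x).1 (by linarith [(h01 x).2])]
    simp
  rw [lintegral_congr this]
  simp

theorem Label.neg_ne_pos : Label.neg ≠ Label.pos := by
  intro h
  have := congrArg Subtype.val h
  norm_num [Label.neg, Label.pos] at this

/-- If `η'` vanishes on `B` and agrees with `η` off `B`, then `jointMeasure η` is dominated by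
`jointMeasure η'` away from the points of `B` with label `1`. -/
theorem jointMeasure_restrict_le {d : ℕ} {η η' : Cube d → ℝ} (hη : Measurable η)
    (hη' : Measurable η') {B : Set (Cube d)} (hB : MeasurableSet B)
    (h0 : ∀ x, 0 ≤ η x) (hon : ∀ x ∈ B, η' x = 0) (hoff : ∀ x ∉ B, η' x = η x) :
    (jointMeasure η).restrict (B ×ˢ {Label.pos})ᶜ ≤ jointMeasure η' := by
  rw [Measure.le_iff]
  intro s hs
  have hE : MeasurableSet (B ×ˢ {Label.pos} : Set (Cube d × Label))ᶜ :=
    (hB.prod (measurableSet_singleton _)).compl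
  rw [Measure.restrict_apply hs, jointMeasure_apply hη (hs.inter hE), jointMeasure_apply hη' hs]
  refine lintegral_mono fun x => ?_
  by_cases hx : x ∈ B
  · have h1 : (x, Label.pos) ∉ s ∩ (B ×ˢ {Label.pos})ᶜ := by simp [hx]
    rw [Set.indicator_of_notMem h1, hon x hx]
    simp only [mul_zero, zero_add, ENNReal.ofReal_zero, zero_mul, sub_zero]
    gcongr
    · linarith [h0 x]
    · exact Set.inter_subset_left
  · rw [hoff x hx]
    gcongr <;> exact Set.inter_subset_left

theorem jointMeasure_prod_pos_le {d : ℕ} {η : Cube d → ℝ} (hη : Measurable η)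
    {B : Set (Cube d)} (hB : MeasurableSet B) {ε : ℝ} (hε : ∀ x ∈ B, η x ≤ ε) :
    jointMeasure η (B ×ˢ {Label.pos}) ≤ ENNReal.ofReal ε * volume B := by
  rw [jointMeasure_apply hη (hB.prod (measurableSet_singleton _)), ← lintegral_indicator_const hB]
  refine lintegral_mono fun x => ?_
  have h1 : (x, Label.neg) ∉ B ×ˢ {Label.pos} := by simp [Label.neg_ne_pos]
  rw [Set.indicator_of_notMem h1, mul_zero, add_zero]
  by_cases hx : x ∈ B
  · rw [Set.indicator_of_mem hx, Set.indicator_of_mem (by simp [hx])]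
    simpa using ENNReal.ofReal_le_ofReal (hε x hx)
  · rw [Set.indicator_of_notMem hx, Set.indicator_of_notMem (by simp [hx])]
    simp

/-- The samples without a point of `B` with label `1` have probability at least `1 - n ε v`, by
Bernoulli's inequality. With `jointMeasure_restrict_le`, this measures how much the sample
distributions of neighbouring hypotheses overlap. -/
theorem half_le_pi_restrict {d n : ℕ} {η : Cube d → ℝ} (hη : Measurable η)
    (h01 : ∀ x, η x ∈ Set.Icc (0 : ℝ) 1) {B : Set (Cube d)} (hB : MeasurableSet B) {ε v : ℝ}
    (hε0 : 0 ≤ ε) (hε : ∀ x ∈ B, η x ≤ ε) (hv : volume B ≤ ENNReal.ofReal v)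
    (hn : n * (ε * v) ≤ 1 / 2) :
    ENNReal.ofReal (1 / 2) ≤
      Measure.pi (fun _ : Fin n => (jointMeasure η).restrict (B ×ˢ {Label.pos})ᶜ) Set.univ := by
  have := isProbabilityMeasure_jointMeasure hη h01
  rw [Measure.pi_univ]
  simp only [Measure.restrict_apply_univ, Finset.prod_const, Finset.card_univ, Fintype.card_fin]
  have hm : MeasurableSet (B ×ˢ {Label.pos} : Set (Cube d × Label)) :=
    hB.prod (measurableSet_singleton _)
  set q : ℝ := (jointMeasure η).real (B ×ˢ {Label.pos}) with hq
  have hq0 : 0 ≤ q := measureReal_nonneg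
  have hq1 : q ≤ 1 := measureReal_le_one
  have hcompl : jointMeasure η (B ×ˢ {Label.pos})ᶜ = ENNReal.ofReal (1 - q) := by
    rw [← probReal_compl_eq_one_sub hm, ofReal_measureReal]
  have hnq : (n : ℝ) * q ≤ 1 / 2 := by
    by_cases hn0 : n = 0
    · simp [hn0]
    have hq2 : ENNReal.ofReal q ≤ ENNReal.ofReal (ε * v) := by
      rw [hq, ofReal_measureReal, ENNReal.ofReal_mul hε0]
      exact (jointMeasure_prod_pos_le hη hB hε).trans (by gcongr)
    rcases le_or_gt 0 (ε * v) with h | h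
    · rw [ENNReal.ofReal_le_ofReal_iff h] at hq2
      exact le_trans (by gcongr) hn
    · rw [ENNReal.ofReal_of_nonpos h.le] at hq2
      have : q ≤ 0 := by simpa using hq2
      nlinarith [Nat.cast_nonneg (α := ℝ) n]
  rw [hcompl, ← ENNReal.ofReal_pow (by linarith)]
  refine ENNReal.ofReal_le_ofReal ?_
  have := one_add_mul_le_pow (a := -q) (by linarith) n
  rw [← sub_eq_add_neg] at this
  linarith

/-! ### Excess logistic risk -/

/-- The expected logistic loss at the score `v` of a label that is `1` with probability `a`. -/
noncomputable def condLoss (a v : ℝ) : ℝ := a * logisticLoss v + (1 - a) * logisticLoss (-v)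

theorem logisticLoss_nonneg (t : ℝ) : 0 ≤ logisticLoss t :=
  Real.log_nonneg (by linarith [Real.exp_pos (-t)])

theorem measurable_logisticLoss : Measurable logisticLoss := by
  unfold logisticLoss
  fun_prop

theorem condLoss_nonneg {a : ℝ} (ha : a ∈ Set.Icc (0 : ℝ) 1) (v : ℝ) : 0 ≤ condLoss a v :=
  add_nonneg (mul_nonneg ha.1 (logisticLoss_nonneg _))
    (mul_nonneg (by linarith [ha.2]) (logisticLoss_nonneg _))

theorem measurable_condLoss {X : Type*} [MeasurableSpace X] {a f : X → ℝ} (ha : Measurable a)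
    (hf : Measurable f) : Measurable fun x => condLoss (a x) (f x) :=
  (ha.mul (measurable_logisticLoss.comp hf)).add
    ((ha.const_sub 1).mul (measurable_logisticLoss.comp hf.neg))

/-- Gibbs' inequality: the tangent line bound for the logarithm, at `c`, of `-log p` where
`p = 1 / (1 + exp (-v))`. -/
theorem le_logisticLoss {c : ℝ} (hc : 0 < c) (v : ℝ) :
    -Real.log c - ((1 + Real.exp (-v))⁻¹ / c - 1) ≤ logisticLoss v := by
  have hp : 0 < (1 + Real.exp (-v))⁻¹ := by positivity
  have := Real.log_le_sub_one_of_pos (div_pos hp hc)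
  rw [Real.log_div hp.ne' hc.ne', Real.log_inv] at this
  rw [logisticLoss]
  linarith

/-- No score does well under both label probabilities `ε` and `0`: the two excess losses add up to
at least a multiple of `ε`. The reference score `s` is the minimizer for the label probability `ε`;
the loss of the score `t` under the label probability `0`, where no minimizer exists, is negligible. -/
theorem exists_condLoss_separation {ε : ℝ} (hε : 0 < ε) (hε2 : ε ≤ 1 / 2) :
    ∃ s t : ℝ, ∀ v, ε / 4 ≤
      (condLoss ε v - condLoss ε s) + (condLoss 0 v - condLoss 0 t) := by
  refine ⟨Real.log (ε / (1 - ε)), Real.log (ε / 10), fun v => ?_⟩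
  have h1ε : 0 < 1 - ε := by linarith
  have hs1 : logisticLoss (Real.log (ε / (1 - ε))) = -Real.log ε := by
    rw [logisticLoss, ← Real.log_inv, Real.exp_log (by positivity), ← Real.log_inv]
    congr 1
    field_simp
    ring
  have hs2 : logisticLoss (-Real.log (ε / (1 - ε))) = -Real.log (1 - ε) := by
    rw [logisticLoss, neg_neg, Real.exp_log (by positivity), ← Real.log_inv]
    congr 1
    field_simp
    ring
  have ht : logisticLoss (-Real.log (ε / 10)) ≤ ε / 10 := by
    rw [logisticLoss, neg_neg, Real.exp_log (by positivity)]
    have := Real.log_le_sub_one_of_pos (show 0 < 1 + ε / 10 by positivity)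
    linarith
  have hv1 := le_logisticLoss (c := ε / 2) (by positivity) v
  have hv2 := le_logisticLoss (c := 1 - ε / 2) (by linarith) (-v)
  rw [neg_neg] at hv2
  have hsum : (1 + Real.exp (-v))⁻¹ + (1 + Real.exp v)⁻¹ = 1 := by
    have := Real.exp_pos v
    rw [Real.exp_neg]
    field_simp
    ring
  set p := (1 + Real.exp (-v))⁻¹
  set p' := (1 + Real.exp v)⁻¹
  have hgibbs : -ε * Real.log (ε / 2) - (2 - ε) * Real.log (1 - ε / 2) ≤
      ε * logisticLoss v + (2 - ε) * logisticLoss (-v) := by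
    have e1 : ε * (p / (ε / 2) - 1) = 2 * p - ε := by field_simp
    have e2 : (2 - ε) * (p' / (1 - ε / 2) - 1) = 2 * p' - (2 - ε) := by
      have := div_mul_cancel₀ p' (show 1 - ε / 2 ≠ 0 by linarith)
      linear_combination 2 * this
    have m1 := mul_le_mul_of_nonneg_left hv1 hε.le
    have m2 := mul_le_mul_of_nonneg_left hv2 (show 0 ≤ 2 - ε by linarith)
    nlinarith
  have hlog2 : Real.log (ε / 2) = Real.log ε - Real.log 2 :=
    Real.log_div hε.ne' (by norm_num)
  have hl2 := Real.log_two_gt_d9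
  have hA : Real.log (1 - ε / 2) ≤ -(ε / 2) := by
    have := Real.log_le_sub_one_of_pos (show 0 < 1 - ε / 2 by linarith)
    linarith
  have hB : -ε ≤ (1 - ε) * Real.log (1 - ε) := by
    have := Real.log_le_sub_one_of_pos (show 0 < (1 - ε)⁻¹ by positivity)
    rw [Real.log_inv] at this
    have h3 := mul_le_mul_of_nonneg_left this h1ε.le
    have h4 : (1 - ε) * ((1 - ε)⁻¹ - 1) = ε := by field_simp; ring
    rw [h4] at h3
    linarith
  have hA' := mul_le_mul_of_nonneg_left hA (show 0 ≤ 2 - ε by linarith)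
  simp only [condLoss, hs1, hs2, zero_mul, zero_add, sub_zero, one_mul]
  rw [hlog2] at hgibbs
  nlinarith

theorem risk_jointMeasure {d : ℕ} {η : Cube d → ℝ} (hη : Measurable η)
    (h01 : ∀ x, η x ∈ Set.Icc (0 : ℝ) 1) (f : MeasFun d) :
    risk (jointMeasure η) f = ∫⁻ x, ENNReal.ofReal (condLoss (η x) (f.1 x)) := by
  have hf := f.2
  have hm : Measurable fun p : Cube d × Label =>
      ENNReal.ofReal (logisticLoss ((p.2 : ℝ) * f.1 p.1)) :=
    (measurable_logisticLoss.comp ((measurable_subtype_coe.comp measurable_snd).mul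
      (hf.comp measurable_fst))).ennreal_ofReal
  rw [risk, lintegral_jointMeasure hη hm]
  refine lintegral_congr fun x => ?_
  have h0 := (h01 x).1
  have h1 : 0 ≤ 1 - η x := by linarith [(h01 x).2]
  rw [condLoss, ENNReal.ofReal_add (mul_nonneg h0 (logisticLoss_nonneg _))
    (mul_nonneg h1 (logisticLoss_nonneg _)), ENNReal.ofReal_mul h0, ENNReal.ofReal_mul h1]
  simp [Label.pos, Label.neg]

/-- The excess risk is bounded below by comparison with any measurable `g`: take at each point the
better of `f` and `g` as the competitor. -/
theorem lintegral_condLoss_sub_le_excessRisk {d : ℕ} {η : Cube d → ℝ} (hη : Measurable η)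
    (h01 : ∀ x, η x ∈ Set.Icc (0 : ℝ) 1) (f g : MeasFun d) :
    ∫⁻ x, ENNReal.ofReal (condLoss (η x) (f.1 x) - condLoss (η x) (g.1 x)) ≤
      excessRisk (jointMeasure η) f := by
  have hmf := measurable_condLoss hη f.2
  have hmg := measurable_condLoss hη g.2
  classical
  let h : MeasFun d := ⟨fun x => if condLoss (η x) (f.1 x) ≤ condLoss (η x) (g.1 x)
    then f.1 x else g.1 x, Measurable.ite (measurableSet_le hmf hmg) f.2 g.2⟩
  have htop : (⨅ g : MeasFun d, risk (jointMeasure η) g) ≠ ∞ := by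
    refine ne_top_of_le_ne_top ?_ (iInf_le _ (⟨fun _ => 0, measurable_const⟩ : MeasFun d))
    have hc : ∀ a, condLoss a 0 = logisticLoss 0 := fun a => by
      simp only [condLoss, neg_zero]
      ring
    rw [risk_jointMeasure hη h01]
    simp [hc]
  refine ENNReal.le_sub_of_add_le_left htop ?_
  calc (⨅ g : MeasFun d, risk (jointMeasure η) g)
        + ∫⁻ x, ENNReal.ofReal (condLoss (η x) (f.1 x) - condLoss (η x) (g.1 x))
      ≤ risk (jointMeasure η) h
        + ∫⁻ x, ENNReal.ofReal (condLoss (η x) (f.1 x) - condLoss (η x) (g.1 x)) := by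
        gcongr
        exact iInf_le _ h
    _ = ∫⁻ x, (ENNReal.ofReal (condLoss (η x) (h.1 x))
        + ENNReal.ofReal (condLoss (η x) (f.1 x) - condLoss (η x) (g.1 x))) := by
        rw [risk_jointMeasure hη h01,
          lintegral_add_left (measurable_condLoss hη h.2).ennreal_ofReal]
    _ = risk (jointMeasure η) f := by
        rw [risk_jointMeasure hη h01]
        refine lintegral_congr fun x => ?_
        by_cases hx : condLoss (η x) (f.1 x) ≤ condLoss (η x) (g.1 x)
        · rw [ENNReal.ofReal_of_nonpos (sub_nonpos.2 hx), add_zero]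
          simp only [h, if_pos hx]
        · simp only [h, if_neg hx]
          rw [← ENNReal.ofReal_add (condLoss_nonneg (h01 x) _) (by linarith)]
          congr 1
          ring

theorem sum_setLIntegral_le_excessRisk {d : ℕ} {ι : Type*} [Fintype ι] {η : Cube d → ℝ}
    (hη : Measurable η) (h01 : ∀ x, η x ∈ Set.Icc (0 : ℝ) 1) {D : ι → Set (Cube d)}
    (hD : ∀ j, MeasurableSet (D j)) (hdisj : Pairwise (Function.onFun Disjoint D))
    (b s : ι → ℝ) (hb : ∀ j, ∀ x ∈ D j, η x = b j) (f : MeasFun d) :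
    ∑ j, ∫⁻ x in D j, ENNReal.ofReal (condLoss (b j) (f.1 x) - condLoss (b j) (s j)) ≤
      excessRisk (jointMeasure η) f := by
  classical
  have hg : Measurable fun x => ∑ j, (D j).indicator (fun _ => s j) x :=
    Finset.measurable_sum _ fun j _ => measurable_const.indicator (hD j)
  refine le_trans ?_ (lintegral_condLoss_sub_le_excessRisk hη h01 f ⟨_, hg⟩)
  refine le_trans (le_of_eq ?_) (setLIntegral_le_lintegral (⋃ j, D j) _)
  rw [lintegral_iUnion hD hdisj, tsum_fintype]
  refine Finset.sum_congr rfl fun j _ => setLIntegral_congr_fun (hD j) fun x hx => ?_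
  have : ∑ i, (D i).indicator (fun _ => s i) x = s j := by
    rw [Finset.sum_eq_single j]
    · exact Set.indicator_of_mem hx _
    · intro i _ hij
      exact Set.indicator_of_notMem (Set.disjoint_left.1 (hdisj hij.symm) hx) _
    · simp
  simp only [this, hb j x hx]

/-! ### Membership in Hölder balls -/

theorem holderNorm_le {d k : ℕ} {lam : ℝ} {F : (Fin d → ℝ) → ℝ} {a b : ℝ}
    (hb : 0 ≤ b)
    (h1 : ∀ l ≤ k, ∀ (j : Fin l → Fin d), ∀ x ∈ cubeSet d, |partialDeriv F j x| ≤ a)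
    (h2 : ∀ (j : Fin k → Fin d), ∀ x ∈ cubeSet d, ∀ z ∈ cubeSet d, x ≠ z →
      |partialDeriv F j x - partialDeriv F j z| ≤ b * ‖x - z‖ ^ lam)
    (hlam : 0 ≤ lam) :
    holderNorm k lam F ≤ ENNReal.ofReal a + ENNReal.ofReal b := by
  unfold holderNorm
  gcongr
  · exact iSup₂_le fun l hl => iSup_le fun j => iSup₂_le fun x hx =>
      ENNReal.ofReal_le_ofReal (h1 l hl j x hx)
  · refine iSup_le fun j => iSup₂_le fun x hx => iSup₂_le fun z hz => iSup_le fun hxz =>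
      ENNReal.ofReal_le_ofReal ?_
    have hne : (WithLp.toLp 2 (x - z) : EuclideanSpace ℝ (Fin d)) ≠ 0 := by
      intro h
      apply hxz
      have := congrArg WithLp.ofLp h
      exact sub_eq_zero.1 (by simpa using this)
    have hpos := norm_pos_iff.2 hne
    rw [div_le_iff₀ (Real.rpow_pos_of_pos hpos _)]
    refine (h2 j x hx z hz hxz).trans ?_
    gcongr
    refine (pi_norm_le_iff_of_nonneg (norm_nonneg _)).2 fun i => ?_
    exact PiLp.norm_apply_le (WithLp.toLp 2 (x - z) : EuclideanSpace ℝ (Fin d)) i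

theorem uniqueDiffOn_cubeSet (d : ℕ) : UniqueDiffOn ℝ (cubeSet d) := by
  have : cubeSet d = Set.univ.pi fun _ => Set.Icc (0 : ℝ) 1 := by
    ext x
    simp [cubeSet, Pi.le_def]
  rw [this]
  exact UniqueDiffOn.pi fun i _ => uniqueDiffOn_Icc_zero_one

/-- The exponents in the definition of `holderBall`: `β = k + lam` with `0 < lam ≤ 1`. -/
theorem holder_exponents {β : ℝ} (hβ : 0 < β) :
    ((⌈β⌉₊ - 1 : ℕ) : ℝ) = β - (β - ⌈β⌉₊ + 1) ∧ 0 < β - ⌈β⌉₊ + 1 ∧ β - ⌈β⌉₊ + 1 ≤ 1 := by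
  have h1 : 1 ≤ ⌈β⌉₊ := Nat.one_le_ceil_iff.2 hβ
  have h2 := Nat.ceil_lt_add_one hβ.le
  have h3 := Nat.le_ceil β
  push_cast [Nat.cast_sub h1]
  refine ⟨by ring, by linarith, by linarith⟩

/-- Shrinking a smooth function `U` on `[0, M]^d` to the unit cube and damping it by `M ^ (-β)`
keeps its Hölder norm of order `β` bounded, uniformly in `M`: the Hölder seminorm follows by
interpolating between the bounds of `U` and its derivatives up to one order above `k`. -/
theorem rescaled_mem_holderBall {d : ℕ} {β r : ℝ} (hβ : 0 < β)
    {U : (Fin d → ℝ) → ℝ} (hU : ContDiff ℝ (⊤ : ℕ∞) U) {M B c : ℝ} (hM : 1 ≤ M) (hc : 0 ≤ c)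
    (hB : ∀ l ≤ ⌈β⌉₊, ∀ y ∈ Set.Icc (0 : Fin d → ℝ) (fun _ => M), ‖iteratedFDeriv ℝ l U y‖ ≤ B)
    (hr : 3 * (c * B) ≤ r) :
    (fun x : Cube d => c * M ^ (-β) * U (M • x.toReal)) ∈ holderBall d β r := by
  obtain ⟨hk, hlam0, hlam1⟩ := holder_exponents hβ
  have hk1 : ⌈β⌉₊ - 1 + 1 = ⌈β⌉₊ := Nat.sub_add_cancel (Nat.one_le_ceil_iff.2 hβ)
  set lam := β - ⌈β⌉₊ + 1 with hlam
  set k := ⌈β⌉₊ - 1 with hkdef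
  have hM0 : 0 < M := by linarith
  set a := c * M ^ (-β) with ha
  have ha0 : 0 ≤ a := mul_nonneg hc (Real.rpow_nonneg hM0.le _)
  set F : (Fin d → ℝ) → ℝ := fun x => a * U (M • x) with hF
  have hUl : ∀ l : ℕ, ContDiff ℝ l U := fun l => hU.of_le (by exact_mod_cast le_top)
  have hUM : ∀ l : ℕ, ContDiff ℝ l fun x => U (M • x) := fun l =>
    (hUl l).comp (contDiff_const_smul M)
  have hFl : ∀ l : ℕ, ContDiff ℝ l F := fun l => contDiff_const.mul (hUM l)
  have hB0 : 0 ≤ B := (norm_nonneg _).trans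
    (hB 0 (Nat.zero_le _) 0 ⟨le_rfl, fun _ => hM0.le⟩)
  have hmem : ∀ x ∈ cubeSet d, M • x ∈ Set.Icc (0 : Fin d → ℝ) (fun _ => M) := by
    intro x hx
    refine ⟨fun i => ?_, fun i => ?_⟩
    · simpa using mul_nonneg hM0.le (hx.1 i)
    · simpa using mul_le_mul_of_nonneg_left (hx.2 i) hM0.le
  have hpd : ∀ (l : ℕ) (j : Fin l → Fin d), ∀ x ∈ cubeSet d, partialDeriv F j x =
      a * M ^ l * iteratedFDeriv ℝ l U (M • x) (fun t => Pi.single (j t) 1) := by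
    intro l j x hx
    rw [partialDeriv, iteratedFDerivWithin_eq_iteratedFDeriv (uniqueDiffOn_cubeSet d)
      (hFl l).contDiffAt hx]
    have h1 : iteratedFDeriv ℝ l F x = a • iteratedFDeriv ℝ l (fun x => U (M • x)) x :=
      iteratedFDeriv_const_smul_apply (a := a) (hUM l).contDiffAt (x := x)
    rw [h1, iteratedFDeriv_comp_const_smul M (hUl l)]
    simp only [smul_apply, smul_eq_mul]
    ring
  have hop : ∀ (l : ℕ) (T : ContinuousMultilinearMap ℝ (fun _ : Fin l => Fin d → ℝ) ℝ)
      (j : Fin l → Fin d), |T (fun t => Pi.single (j t) 1)| ≤ ‖T‖ := by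
    intro l T j
    have := T.le_opNorm (fun t => Pi.single (j t) 1)
    simpa [Pi.norm_single] using this
  have hscale : a * M ^ k = c * M ^ (-lam) := by
    rw [ha, mul_assoc, ← Real.rpow_natCast, ← Real.rpow_add hM0, hk]
    congr 2
    ring
  refine ⟨F, fun x => rfl, (hFl k).contDiffOn, ?_⟩
  have hmain : holderNorm k lam F ≤ ENNReal.ofReal (c * B) + ENNReal.ofReal (2 * (c * B)) := by
    refine holderNorm_le (by positivity) ?_ ?_ hlam0.le
    · intro l hl j x hx
      rw [hpd l j x hx, abs_mul, abs_of_nonneg (by positivity)]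
      have h1 : a * M ^ l ≤ c := by
        calc a * M ^ l ≤ a * M ^ k := by gcongr
          _ = c * M ^ (-lam) := hscale
          _ ≤ c * 1 := by
            gcongr
            exact Real.rpow_le_one_of_one_le_of_nonpos hM (by linarith)
          _ = c := mul_one c
      exact mul_le_mul h1 ((hop l _ j).trans (hB l (by omega) _ (hmem x hx)))
        (abs_nonneg _) hc
    · intro j x hx z hz _
      rw [hpd k j x hx, hpd k j z hz, ← mul_sub, abs_mul, abs_of_nonneg (by positivity), hscale,
        ← sub_apply]
      set D := iteratedFDeriv ℝ k U (M • x) - iteratedFDeriv ℝ k U (M • z) with hD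
      have hD1 : ‖D‖ ≤ 2 * B := by
        refine (norm_sub_le _ _).trans ?_
        linarith [hB k (by omega) _ (hmem x hx), hB k (by omega) _ (hmem z hz)]
      have hD2 : ‖D‖ ≤ B * (M * ‖x - z‖) := by
        have h := Convex.norm_image_sub_le_of_norm_fderiv_le (𝕜 := ℝ)
          (f := iteratedFDeriv ℝ k U) (C := B) (s := Set.Icc (0 : Fin d → ℝ) (fun _ => M))
          (fun y _ => (hU.differentiable_iteratedFDeriv (by exact_mod_cast WithTop.coe_lt_top _)) y)
          (fun y hy => by
            rw [norm_fderiv_iteratedFDeriv]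
            exact hB _ (by omega) y hy) (convex_Icc _ _) (hmem z hz) (hmem x hx)
        rwa [← smul_sub, norm_smul, Real.norm_of_nonneg hM0.le] at h
      have hD3 : ‖D‖ ≤ 2 * B * (M * ‖x - z‖) ^ lam := by
        have hn : 0 ≤ M * ‖x - z‖ := by positivity
        rcases le_total 1 (M * ‖x - z‖) with h | h
        · have := Real.one_le_rpow h hlam0.le
          exact hD1.trans (le_mul_of_one_le_right (by positivity) this)
        · have h3 : M * ‖x - z‖ ≤ (M * ‖x - z‖) ^ lam := by
            rcases hn.eq_or_lt with h0 | h0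
            · rw [← h0, Real.zero_rpow hlam0.ne']
            · simpa using Real.rpow_le_rpow_of_exponent_ge h0 h hlam1
          calc ‖D‖ ≤ B * (M * ‖x - z‖) := hD2
            _ ≤ 2 * B * (M * ‖x - z‖) := by nlinarith [mul_nonneg hB0 hn]
            _ ≤ _ := by gcongr
      calc c * M ^ (-lam) * |D fun t => Pi.single (j t) 1|
          ≤ c * M ^ (-lam) * (2 * B * (M * ‖x - z‖) ^ lam) := by
            gcongr
            exact (hop k D j).trans hD3
        _ = 2 * (c * B) * ‖x - z‖ ^ lam := by
            rw [Real.mul_rpow hM0.le (norm_nonneg _), Real.rpow_neg hM0.le]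
            have := (Real.rpow_pos_of_pos hM0 lam).ne'
            field_simp
  refine hmain.trans ?_
  rw [← ENNReal.ofReal_add (by positivity) (by positivity)]
  exact ENNReal.ofReal_le_ofReal (by linarith)

theorem exists_bound_of_forall_exists {E : Type*} {S : Set E} {f : ℕ → E → ℝ} (N : ℕ)
    (h : ∀ l, ∃ C, ∀ y ∈ S, f l y ≤ C) : ∃ B, 0 < B ∧ ∀ l ≤ N, ∀ y ∈ S, f l y ≤ B := by
  choose C hC using h
  refine ⟨1 + ∑ l ∈ Finset.range (N + 1), |C l|, by positivity, fun l hl y hy => ?_⟩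
  have := Finset.single_le_sum (f := fun l => |C l|) (fun i _ => abs_nonneg _)
    (Finset.mem_range.2 (Nat.lt_succ_of_le hl))
  have h2 := hC l y hy
  have h3 := le_abs_self (C l)
  linarith

theorem exists_coordinate_rpow_mem_holderBall {d : ℕ} (i : Fin d) {β r : ℝ} (hβ : 0 < β)
    (hr : 0 < r) : ∃ c, 0 < c ∧ c ≤ 1 ∧
      (fun x : Cube d => c * (x i : ℝ) ^ (min 1 β)) ∈ holderBall d β r := by
  rcases le_or_gt β 1 with h1 | h1
  · -- the Hölder ball of order `β ≤ 1` constrains no derivatives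
    refine ⟨min 1 (r / 2), by positivity, min_le_left _ _, ?_⟩
    set c := min 1 (r / 2)
    have hc : 0 < c := by positivity
    have hc2 : c ≤ r / 2 := min_le_right _ _
    have hceil : ⌈β⌉₊ = 1 :=
      le_antisymm (Nat.ceil_le.2 (by simpa using h1)) (Nat.one_le_ceil_iff.2 hβ)
    refine ⟨fun x => c * x i ^ β, fun x => ?_, ?_, ?_⟩
    · rw [min_eq_right h1]
      rfl
    · rw [hceil]
      refine contDiffOn_zero.2 (Continuous.continuousOn ?_)
      exact continuous_const.mul ((continuous_apply i).rpow_const fun _ => Or.inr hβ.le)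
    · rw [hceil]
      simp only [Nat.cast_one, Nat.sub_self, sub_add_cancel]
      have hpow : ∀ s t : ℝ, 0 ≤ s → 0 ≤ t → s ^ β - t ^ β ≤ |s - t| ^ β := by
        intro s t hs ht
        have h2 := Real.rpow_add_le_add_rpow ht (abs_nonneg (s - t)) hβ.le h1
        have h3 : s ^ β ≤ (t + |s - t|) ^ β :=
          Real.rpow_le_rpow hs (by linarith [le_abs_self (s - t)]) hβ.le
        linarith
      refine (holderNorm_le (a := c) (b := c) hc.le ?_ ?_ hβ.le).trans ?_
      · intro l hl j x hx
        obtain rfl : l = 0 := Nat.le_zero.1 hl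
        rw [partialDeriv, iteratedFDerivWithin_zero_apply, abs_of_nonneg
          (mul_nonneg hc.le (Real.rpow_nonneg (hx.1 i) _))]
        exact mul_le_of_le_one_right hc.le (Real.rpow_le_one (hx.1 i) (hx.2 i) hβ.le)
      · intro j x hx z hz _
        simp only [partialDeriv, iteratedFDerivWithin_zero_apply]
        rw [← mul_sub, abs_mul, abs_of_pos hc]
        gcongr
        have h4 : |x i - z i| ^ β ≤ ‖x - z‖ ^ β := by
          gcongr
          exact norm_le_pi_norm (x - z) i
        refine le_trans (abs_le.2 ⟨?_, hpow _ _ (hx.1 i) (hz.1 i)⟩) h4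
        have := hpow _ _ (hz.1 i) (hx.1 i)
        rw [abs_sub_comm] at this
        linarith
      · rw [← ENNReal.ofReal_add hc.le hc.le]
        exact ENNReal.ofReal_le_ofReal (by linarith)
  · have hU : ContDiff ℝ (⊤ : ℕ∞) fun y : Fin d → ℝ => y i := contDiff_apply ℝ ℝ i
    obtain ⟨B, hB0, hB⟩ := exists_bound_of_forall_exists
      (S := Set.Icc (0 : Fin d → ℝ) fun _ => 1)
      (f := fun l y => ‖iteratedFDeriv ℝ l (fun y : Fin d → ℝ => y i) y‖) ⌈β⌉₊ fun l => by
        obtain ⟨C, hC⟩ := isCompact_Icc.exists_bound_of_continuousOn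
          (s := Set.Icc (0 : Fin d → ℝ) fun _ => 1)
          (hU.continuous_iteratedFDeriv (m := l) (by exact_mod_cast le_top)).continuousOn
        exact ⟨C, hC⟩
    refine ⟨min 1 (r / (3 * B)), by positivity, min_le_left _ _, ?_⟩
    have hc : 3 * (min 1 (r / (3 * B)) * B) ≤ r := by
      have : min 1 (r / (3 * B)) ≤ r / (3 * B) := min_le_right _ _
      rw [le_div_iff₀ (by positivity)] at this
      linarith
    have := rescaled_mem_holderBall hβ hU le_rfl (by positivity) hB hc
    simpa [min_eq_left h1.le, Cube.toReal] using this

/-! ### Sums of bumps on a grid -/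

/-- A smooth bump in the middle of the unit cell `[0,1]^d`, equal to `1` on `[1/4, 3/4]^d` and
supported in `[1/6, 5/6]^d`; the norm of `Fin d → ℝ` is the sup norm, so its balls are cubes. -/
noncomputable def cellBump (d : ℕ) : ContDiffBump (fun _ : Fin d => (1 / 2 : ℝ)) where
  rIn := 1 / 4
  rOut := 1 / 3
  rIn_pos := by norm_num
  rIn_lt_rOut := by norm_num

/-- The cube of half side length `ρ` about the centre of the unit cell with lower corner `j`. -/
def cell {d M : ℕ} (ρ : ℝ) (j : Fin d → Fin M) : Set (Fin d → ℝ) :=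
  {y | ∀ i, |y i - j i - 1 / 2| ≤ ρ}

theorem mem_cell_iff {d M : ℕ} {ρ : ℝ} (hρ : 0 ≤ ρ) {j : Fin d → Fin M} {y : Fin d → ℝ} :
    y ∈ cell ρ j ↔ (y - fun i => (j i : ℝ)) ∈ Metric.closedBall (fun _ => 1 / 2) ρ := by
  rw [Metric.mem_closedBall, dist_pi_le_iff hρ]
  rfl

theorem cell_disjoint {d M : ℕ} {ρ : ℝ} (hρ : ρ < 1 / 2) {j j' : Fin d → Fin M} {y : Fin d → ℝ}
    (h : y ∈ cell ρ j) (h' : y ∈ cell ρ j') : j = j' := by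
  funext i
  have h1 := abs_le.1 (h i)
  have h2 := abs_le.1 (h' i)
  have h3 : ((j i : ℕ) : ℝ) < (j' i : ℕ) + 1 := by linarith
  have h4 : ((j' i : ℕ) : ℝ) < (j i : ℕ) + 1 := by linarith
  norm_cast at h3 h4
  omega

/-- The sum of the bumps in the cells `j` of the grid `[0,M]^d` with `τ j = true`. -/
noncomputable def bumpSum {d M : ℕ} (τ : (Fin d → Fin M) → Bool) (y : Fin d → ℝ) : ℝ :=
  ∑ j, if τ j then cellBump d (y - fun i => (j i : ℝ)) else 0

theorem cellBump_sub_eq_zero {d M : ℕ} {j : Fin d → Fin M} {y : Fin d → ℝ}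
    (h : y ∉ cell (1 / 3) j) : cellBump d (y - fun i => (j i : ℝ)) = 0 := by
  rw [mem_cell_iff (by norm_num)] at h
  exact image_eq_zero_of_notMem_tsupport (by rwa [ContDiffBump.tsupport_eq])

theorem bumpSum_eq_of_mem {d M : ℕ} {τ : (Fin d → Fin M) → Bool} {j : Fin d → Fin M}
    {y : Fin d → ℝ} (h : y ∈ cell (1 / 3) j) :
    bumpSum τ y = if τ j then cellBump d (y - fun i => (j i : ℝ)) else 0 := by
  refine Finset.sum_eq_single j (fun i _ hij => ?_) (by simp)
  rw [cellBump_sub_eq_zero fun h' => hij (cell_disjoint (by norm_num) h' h), ite_self]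

theorem bumpSum_eq_of_mem_core {d M : ℕ} {τ : (Fin d → Fin M) → Bool} {j : Fin d → Fin M}
    {y : Fin d → ℝ} (h : y ∈ cell (1 / 4) j) : bumpSum τ y = if τ j then 1 else 0 := by
  rw [bumpSum_eq_of_mem fun i => (h i).trans (by norm_num),
    ContDiffBump.one_of_mem_closedBall _ ((mem_cell_iff (ρ := 1 / 4) (by norm_num)).1 h)]

theorem bumpSum_congr {d M : ℕ} {τ τ' : (Fin d → Fin M) → Bool} {y : Fin d → ℝ}
    (h : ∀ j, y ∈ cell (1 / 3) j → τ j = τ' j) : bumpSum τ y = bumpSum τ' y := by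
  refine Finset.sum_congr rfl fun j _ => ?_
  by_cases hj : y ∈ cell (1 / 3) j
  · rw [h j hj]
  · rw [cellBump_sub_eq_zero hj, ite_self, ite_self]

theorem bumpSum_mem_Icc {d M : ℕ} (τ : (Fin d → Fin M) → Bool) (y : Fin d → ℝ) :
    bumpSum τ y ∈ Set.Icc (0 : ℝ) 1 := by
  by_cases h : ∃ j : Fin d → Fin M, y ∈ cell (1 / 3) j
  · obtain ⟨j, hj⟩ := h
    rw [bumpSum_eq_of_mem hj]
    split_ifs
    · exact ⟨ContDiffBump.nonneg _, ContDiffBump.le_one _⟩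
    · simp
  · push Not at h
    rw [bumpSum, Finset.sum_eq_zero fun j _ => by rw [cellBump_sub_eq_zero (h j), ite_self]]
    simp

theorem contDiff_bumpSum {d M : ℕ} (τ : (Fin d → Fin M) → Bool) :
    ContDiff ℝ (⊤ : ℕ∞) (bumpSum τ) := by
  refine ContDiff.sum fun j _ => ?_
  split_ifs
  · exact (cellBump d).contDiff.comp (contDiff_id.sub contDiff_const)
  · exact contDiff_const

/-- The derivatives of a sum of bumps obey the bounds for a single bump, as the supports are
disjoint. -/
theorem exists_bound_iteratedFDeriv_bumpSum (d N : ℕ) : ∃ B, 0 < B ∧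
    ∀ (M : ℕ) (τ : (Fin d → Fin M) → Bool), ∀ l ≤ N, ∀ y,
      ‖iteratedFDeriv ℝ l (bumpSum τ) y‖ ≤ B := by
  have hu : ContDiff ℝ (⊤ : ℕ∞) (cellBump d) := (cellBump d).contDiff
  obtain ⟨B, hB0, hB⟩ := exists_bound_of_forall_exists (S := Set.univ)
    (f := fun l y => ‖iteratedFDeriv ℝ l (cellBump d) y‖) N fun l => by
      obtain ⟨C, hC⟩ := (hu.continuous_iteratedFDeriv (m := l)
        (by exact_mod_cast le_top)).bounded_above_of_compact_support
        ((cellBump d).hasCompactSupport.iteratedFDeriv l)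
      exact ⟨C, fun y _ => hC y⟩
  refine ⟨B, hB0, fun M τ l hl y => ?_⟩
  set f : (Fin d → Fin M) → (Fin d → ℝ) → ℝ := fun j y =>
    if τ j then cellBump d (y - fun i => (j i : ℝ)) else 0 with hf
  have hsum : bumpSum τ = ∑ j, f j := by
    funext y
    simp [bumpSum, hf]
  have hsmooth : ∀ j, ContDiff ℝ l (f j) := by
    intro j
    simp only [hf]
    split_ifs
    · exact (hu.of_le (by exact_mod_cast le_top)).comp (contDiff_id.sub contDiff_const)
    · exact contDiff_const
  have hfj : ∀ j, iteratedFDeriv ℝ l (f j) y =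
      if τ j then iteratedFDeriv ℝ l (cellBump d) (y - fun i => (j i : ℝ)) else 0 := by
    intro j
    simp only [hf]
    split_ifs
    · exact iteratedFDeriv_comp_sub l _ y
    · simp
  have hzero : ∀ j, y ∉ cell (1 / 3) j → iteratedFDeriv ℝ l (f j) y = 0 := by
    intro j hj
    rw [hfj]
    split_ifs
    · refine image_eq_zero_of_notMem_tsupport fun h => hj ?_
      have := tsupport_iteratedFDeriv_subset l h
      rw [ContDiffBump.tsupport_eq] at this
      exact (mem_cell_iff (by norm_num)).2 this
    · rfl
  rw [hsum, iteratedFDeriv_sum_apply fun j _ => (hsmooth j).contDiffAt]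
  by_cases h : ∃ j : Fin d → Fin M, y ∈ cell (1 / 3) j
  · obtain ⟨j, hj⟩ := h
    rw [Finset.sum_eq_single j
      (fun i _ hij => hzero i fun h' => hij (cell_disjoint (by norm_num) h' hj)) (by simp), hfj]
    split_ifs
    · exact hB l hl _ (Set.mem_univ _)
    · simpa using hB0.le
  · push Not at h
    rw [Finset.sum_eq_zero fun j _ => hzero j (h j)]
    simpa using hB0.le

/-! ### Compositions with a power function -/

theorem iterate_mul_rpow {c α : ℝ} (hc : 0 < c) (hc1 : c ≤ 1) (hα : 0 ≤ α) (q : ℕ) :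
    ∃ C, 0 < C ∧ C ≤ 1 ∧ ∀ t : ℝ, 0 ≤ t → (fun t : ℝ => c * t ^ α)^[q] t = C * t ^ (α ^ q) := by
  induction q with
  | zero => exact ⟨1, one_pos, le_rfl, fun t _ => by simp⟩
  | succ q ih =>
    obtain ⟨C, hC, hC1, h⟩ := ih
    refine ⟨c * C ^ α, by positivity, ?_, fun t ht => ?_⟩
    · exact mul_le_one₀ hc1 (by positivity) (Real.rpow_le_one hC.le hC1 hα)
    · rw [Function.iterate_succ_apply', h t ht, Real.mul_rpow hC.le (Real.rpow_nonneg ht _),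
        ← Real.rpow_mul ht, ← pow_succ, mul_assoc]

/-- Post-composition with `q` copies of a function `ψ` of one coordinate. In the intermediate spaces
all `K` coordinates carry the same value. -/
theorem iterate_comp_mem_compHolder {K dstar : ℕ} {β r : ℝ} {ψ : ℝ → ℝ} (i : Fin dstar)
    (hψ : (fun x : Cube dstar => ψ (x i)) ∈ holderBall dstar β r)
    (hψ01 : ∀ t ∈ I, ψ t ∈ I) (q : ℕ) (hK : q ≠ 0 → dstar ≤ K) {d : ℕ} {f : Cube d → ℝ}
    (hf : f ∈ sparseHolder d dstar β r) (hf01 : ∀ x, f x ∈ I) :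
    (fun x => ψ^[q] (f x)) ∈ compHolder K dstar β r q d := by
  induction q generalizing d f with
  | zero => exact hf
  | succ q ih =>
    have hdK := hK q.succ_ne_zero
    let e : Fin dstar ↪o Fin K := Fin.castLEOrderEmb hdK
    refine ⟨fun x _ => ⟨f x, hf01 x⟩, fun _ => hf, fun y => ψ^[q] (ψ (y (e i))), ?_, ?_⟩
    · exact ih (fun _ => hdK) ⟨e, _, hψ, fun _ => rfl⟩ fun y => hψ01 _ (y (e i)).2
    · rfl

/-! ### Volumes of cells -/

theorem volume_setOf_forall_mem_Icc {d m : ℕ} (e : Fin m ↪o Fin d) (a b : Fin m → I) :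
    volume {x : Cube d | ∀ i, x (e i) ∈ Set.Icc (a i) (b i)} =
      ∏ i, ENNReal.ofReal (b i - a i) := by
  set S : Fin d → Set I := fun k => {t | ∀ i, e i = k → t ∈ Set.Icc (a i) (b i)} with hS
  have h1 : {x : Cube d | ∀ i, x (e i) ∈ Set.Icc (a i) (b i)} = Set.univ.pi S := by
    ext x
    simp only [hS, Set.mem_ofPred_eq, Set.mem_pi, Set.mem_univ, true_imp_iff]
    exact ⟨fun h k i hk => hk ▸ h i, fun h i => h _ i rfl⟩
  rw [h1, volume_pi_pi, ← Finset.prod_subset (Finset.subset_univ (Finset.univ.map e.toEmbedding))]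
  · rw [Finset.prod_map]
    refine Finset.prod_congr rfl fun i _ => ?_
    have : S (e i) = Set.Icc (a i) (b i) := by
      ext t
      simp only [hS, Set.mem_ofPred_eq]
      exact ⟨fun h => h i rfl, fun h k hk => e.injective hk ▸ h⟩
    have h2 : S (e.toEmbedding i) = Set.Icc (a i) (b i) := this
    rw [h2, unitInterval.volume_Icc]
  · intro k _ hk
    have : S k = Set.univ := by
      refine Set.eq_univ_of_forall fun t i hi => absurd ?_ hk
      exact Finset.mem_map.2 ⟨i, Finset.mem_univ _, hi⟩
    rw [this, measure_univ]

/-- The preimage of a cell of the grid `[0,M]^m` under selection of the coordinates `e` and scaling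
by `M`. -/
def cubeCell {d m M : ℕ} (e : Fin m ↪o Fin d) (ρ : ℝ) (j : Fin m → Fin M) : Set (Cube d) :=
  {x | (M : ℝ) • Cube.toReal (x ∘ e) ∈ cell ρ j}

theorem continuous_smul_toReal {d m : ℕ} (M : ℝ) (e : Fin m ↪o Fin d) :
    Continuous fun x : Cube d => M • Cube.toReal (x ∘ e) := by
  unfold Cube.toReal
  simp only [Function.comp_apply]
  fun_prop

theorem measurableSet_cubeCell {d m M : ℕ} (e : Fin m ↪o Fin d) (ρ : ℝ) (j : Fin m → Fin M) :
    MeasurableSet (cubeCell e ρ j) := by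
  have hc : IsClosed (cell (d := m) ρ j) := by
    simp only [cell, Set.ofPred_forall]
    exact isClosed_iInter fun i => isClosed_le (by fun_prop) continuous_const
  exact (hc.preimage (continuous_smul_toReal _ e)).measurableSet

theorem volume_cubeCell {d m M : ℕ} (e : Fin m ↪o Fin d) {ρ : ℝ} (hρ0 : 0 ≤ ρ) (hρ : ρ ≤ 1 / 2)
    (j : Fin m → Fin M) : volume (cubeCell e ρ j) = ENNReal.ofReal ((2 * ρ / M) ^ m) := by
  rcases m.eq_zero_or_pos with rfl | hm
  · have : cubeCell e ρ j = Set.univ := Set.eq_univ_of_forall fun x i => i.elim0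
    rw [this, measure_univ]
    simp
  have hM : (0 : ℝ) < M := by exact_mod_cast (j ⟨0, hm⟩).pos
  have hj : ∀ i, ((j i : ℕ) : ℝ) + 1 ≤ M := fun i => by exact_mod_cast (j i).2
  have hj0 : ∀ i, (0 : ℝ) ≤ (j i : ℕ) := fun i => Nat.cast_nonneg _
  let a : Fin m → I := fun i => ⟨((j i : ℕ) + 1 / 2 - ρ) / M,
    div_nonneg (by linarith [hj0 i]) hM.le, (div_le_one hM).2 (by linarith [hj i])⟩
  let b : Fin m → I := fun i => ⟨((j i : ℕ) + 1 / 2 + ρ) / M,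
    div_nonneg (by linarith [hj0 i]) hM.le, (div_le_one hM).2 (by linarith [hj i])⟩
  have h1 : cubeCell e ρ j = {x : Cube d | ∀ i, x (e i) ∈ Set.Icc (a i) (b i)} := by
    ext x
    refine forall_congr' fun i => ?_
    rw [Set.mem_Icc, ← Subtype.coe_le_coe, ← Subtype.coe_le_coe, div_le_iff₀ hM, le_div_iff₀ hM,
      abs_le]
    simp only [Pi.smul_apply, smul_eq_mul, Cube.toReal, Function.comp_apply]
    constructor <;> rintro ⟨h, h'⟩ <;> constructor <;> linarith
  rw [h1, volume_setOf_forall_mem_Icc]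
  have h2 : ∀ i, ((b i : ℝ) - a i) = 2 * ρ / M := fun i => by
    simp only [a, b]
    ring
  simp only [h2, Finset.prod_const, Finset.card_univ, Fintype.card_fin]
  rw [ENNReal.ofReal_pow (by positivity)]

/-! ### The lower bound for a hypercube of conditional probabilities -/

/-- Assouad's lemma for the logistic risk: conditional probabilities `η τ` that are `ε` or `0` on the
disjoint cores `D j` according to `τ j`, and depend on `τ j` only inside `B j`. -/
theorem le_minimaxRisk_of_hypercube {d n : ℕ} {ι : Type*} [Fintype ι] [DecidableEq ι]
    {H : Set (Measure (Cube d × Label))} {η : (ι → Bool) → Cube d → ℝ}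
    (hη : ∀ τ, Measurable (η τ)) (hη0 : ∀ τ x, 0 ≤ η τ x) (hH : ∀ τ, jointMeasure (η τ) ∈ H)
    {B D : ι → Set (Cube d)} (hB : ∀ j, MeasurableSet (B j)) (hD : ∀ j, MeasurableSet (D j))
    (hdisj : Pairwise (Function.onFun Disjoint D)) {ε v w : ℝ} (hε : 0 < ε) (hε2 : ε ≤ 1 / 2)
    (hle : ∀ τ x, η τ x ≤ ε) (hηD : ∀ τ j, ∀ x ∈ D j, η τ x = if τ j then ε else 0)
    (hηB : ∀ τ j, τ j = false → ∀ x ∈ B j, η τ x = 0)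
    (hoff : ∀ τ j b, ∀ x ∉ B j, η (Function.update τ j b) x = η τ x)
    (hv : ∀ j, volume (B j) ≤ ENNReal.ofReal v) (hw : ∀ j, ENNReal.ofReal w ≤ volume (D j))
    (hn : n * (ε * v) ≤ 1 / 2) :
    Fintype.card ι * (ENNReal.ofReal (ε / 4) * ENNReal.ofReal w * ENNReal.ofReal (1 / 2)) / 2 ≤
      minimaxRisk d n H := by
  have h01 : ∀ τ x, η τ x ∈ Set.Icc (0 : ℝ) 1 := fun τ x =>
    ⟨hη0 τ x, (hle τ x).trans (by linarith)⟩
  have hprob := fun τ => isProbabilityMeasure_jointMeasure (hη τ) (h01 τ)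
  obtain ⟨s, t, hst⟩ := exists_condLoss_separation hε hε2
  refine le_iInf fun T => ENNReal.div_le_of_le_mul' ?_
  let b' : Bool → ℝ := fun b => if b then ε else 0
  let s' : Bool → ℝ := fun b => if b then s else t
  let L : Bool → (Fin n → Cube d × Label) → Cube d → ℝ≥0∞ := fun b z x =>
    ENNReal.ofReal (condLoss (b' b) ((T.1 z).1 x) - condLoss (b' b) (s' b))
  refine (assouad (fun τ => Measure.pi fun _ : Fin n => jointMeasure (η τ))
    (fun j τ => Measure.pi fun _ : Fin n =>
      (jointMeasure (η (Function.update τ j true))).restrict (B j ×ˢ {Label.pos})ᶜ)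
    (fun τ z => excessRisk (jointMeasure (η τ)) (T.1 z)) (fun τ => T.2 _ (hH τ))
    (fun j b z => ∫⁻ x in D j, L b z x) ?_
    (ENNReal.ofReal (ε / 4) * ENNReal.ofReal w) (ENNReal.ofReal (1 / 2)) ?_ ?_ ?_).trans ?_
  · intro τ z
    exact sum_setLIntegral_le_excessRisk (hη τ) (h01 τ) hD hdisj (fun j => b' (τ j))
      (fun j => s' (τ j)) (fun j x hx => hηD τ j x hx) (T.1 z)
  · intro j z
    have hm : Measurable (L true z) :=
      ((measurable_condLoss measurable_const (T.1 z).2).sub_const _).ennreal_ofReal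
    change _ ≤ (∫⁻ x in D j, L true z x) + ∫⁻ x in D j, L false z x
    rw [← lintegral_add_left hm]
    calc ENNReal.ofReal (ε / 4) * ENNReal.ofReal w
        ≤ ENNReal.ofReal (ε / 4) * volume (D j) := by gcongr; exact hw j
      _ = ∫⁻ _ in D j, ENNReal.ofReal (ε / 4) := (setLIntegral_const _ _).symm
      _ ≤ _ := by
          refine lintegral_mono fun x => ?_
          exact (ENNReal.ofReal_le_ofReal (hst _)).trans ENNReal.ofReal_add_le
  · intro j τ b
    refine pi_mono_measure fun _ => ?_
    cases b
    · refine jointMeasure_restrict_le (hη _) (hη _) (hB j) (hη0 _)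
        (hηB _ j (Function.update_self ..)) fun x hx => ?_
      rw [hoff _ _ _ x hx, hoff _ _ _ x hx]
    · exact Measure.restrict_le_self
  · intro j τ
    exact half_le_pi_restrict (hη _) (h01 _) (hB j) hε.le (fun x _ => hle _ x) (hv j) hn
  · gcongr
    exact iSup_le fun τ => le_iSup₂_of_le (f := fun P _ =>
      ∫⁻ z, excessRisk P (T.1 z) ∂(Measure.pi fun _ : Fin n => P)) _ (hH τ) le_rfl

/-! ### The hypercube of sums of bumps -/

/-- The lower bound at grid size `M`, with conditional probabilities of height `κ * M ^ (-s)` on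
`M ^ dstar` cells. The constant `κ` absorbs the Hölder radius and the `q` compositions. -/
theorem exists_le_minimaxRisk_grid {dstar : ℕ} (hdstar : 1 ≤ dstar) {β r : ℝ} (hβ : 0 < β)
    (hr : 0 < r) (q : ℕ) : ∃ κ, 0 < κ ∧ κ ≤ 1 ∧
      ∀ (n d K M : ℕ) (A ε : ℝ), 1 ≤ M → dstar ≤ d → (q ≠ 0 → dstar ≤ K) →
        ε = κ * (M : ℝ) ^ (-(β * (min 1 β) ^ q)) → ε ≤ 1 / 2 → ε < (1 - A) / 2 →
        n * (ε * (1 / M : ℝ) ^ dstar) ≤ 1 / 2 →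
        ENNReal.ofReal (ε / 16 * (1 / 2) ^ dstar) ≤
          minimaxRisk d n (distClass d β r A q K dstar) := by
  set α := min 1 β with hα
  have hα0 : 0 < α := lt_min one_pos hβ
  obtain ⟨c, hc, hc1, hψ⟩ := exists_coordinate_rpow_mem_holderBall (⟨0, hdstar⟩ : Fin dstar) hβ hr
  obtain ⟨C, hC, hC1, hiter⟩ := iterate_mul_rpow hc hc1 hα0.le q
  obtain ⟨B, hB0, hB⟩ := exists_bound_iteratedFDeriv_bumpSum dstar ⌈β⌉₊
  set p := α ^ q with hp
  have hp0 : 0 < p := pow_pos hα0 q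
  set b := min 1 (r / (3 * B)) with hb
  have hb0 : 0 < b := by positivity
  have hb1 : b ≤ 1 := min_le_left _ _
  have hbB : 3 * (b * B) ≤ r := by
    have : b ≤ r / (3 * B) := min_le_right _ _
    rw [le_div_iff₀ (by positivity)] at this
    linarith
  refine ⟨C * b ^ p, by positivity,
    mul_le_one₀ hC1 (by positivity) (Real.rpow_le_one hb0.le hb1 hp0.le), ?_⟩
  intro n d K M A ε hM hd hK hεdef hε2 hεA hn
  have hM1 : (1 : ℝ) ≤ M := by exact_mod_cast hM
  have hM0 : (0 : ℝ) < M := by linarith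
  have hε : 0 < ε := by rw [hεdef]; positivity
  set e : Fin dstar ↪o Fin d := Fin.castLEOrderEmb hd
  set a : ℝ := b * (M : ℝ) ^ (-β) with ha
  have ha0 : 0 < a := by positivity
  have ha1 : a ≤ 1 :=
    mul_le_one₀ hb1 (by positivity) (Real.rpow_le_one_of_one_le_of_nonpos hM1 (by linarith))
  have hεa : ε = C * a ^ p := by
    rw [hεdef, ha, Real.mul_rpow hb0.le (by positivity), ← Real.rpow_mul hM0.le, mul_assoc, neg_mul]
  let f : ((Fin dstar → Fin M) → Bool) → Cube d → ℝ := fun τ x =>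
    a * bumpSum τ ((M : ℝ) • Cube.toReal (x ∘ e))
  have hf0 : ∀ τ x, 0 ≤ f τ x := fun τ x => mul_nonneg ha0.le (bumpSum_mem_Icc _ _).1
  have hfa : ∀ τ x, f τ x ≤ a := fun τ x => mul_le_of_le_one_right ha0.le (bumpSum_mem_Icc _ _).2
  have hfm : ∀ τ, Measurable (f τ) := fun τ =>
    (continuous_const.mul ((contDiff_bumpSum τ).continuous.comp
      (continuous_smul_toReal (M : ℝ) e))).measurable
  have hfs : ∀ τ, f τ ∈ sparseHolder d dstar β r := fun τ =>
    ⟨e, _, rescaled_mem_holderBall hβ (contDiff_bumpSum τ) hM1 hb0.le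
      (fun l hl y _ => hB M τ l hl y) hbB, fun _ => rfl⟩
  let η : ((Fin dstar → Fin M) → Bool) → Cube d → ℝ := fun τ x => C * f τ x ^ p
  have hη0 : ∀ τ x, 0 ≤ η τ x := fun τ x => mul_nonneg hC.le (Real.rpow_nonneg (hf0 τ x) _)
  have hηε : ∀ τ x, η τ x ≤ ε := fun τ x => by
    rw [hεa]
    exact mul_le_mul_of_nonneg_left (Real.rpow_le_rpow (hf0 τ x) (hfa τ x) hp0.le) hC.le
  have hηcomp : ∀ τ, η τ ∈ compHolder K dstar β r q d := fun τ => by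
    have := iterate_comp_mem_compHolder (ψ := fun t => c * t ^ α) _ hψ
      (fun t ht => ⟨mul_nonneg hc.le (Real.rpow_nonneg ht.1 _),
        mul_le_one₀ hc1 (Real.rpow_nonneg ht.1 _) (Real.rpow_le_one ht.1 ht.2 hα0.le)⟩) q hK
      (hfs τ) fun x => ⟨hf0 τ x, (hfa τ x).trans ha1⟩
    simpa only [hiter _ (hf0 τ _)] using this
  have hH : ∀ τ, jointMeasure (η τ) ∈ distClass d β r A q K dstar := fun τ => by
    refine ⟨η τ, hηcomp τ, fun x => ⟨hη0 τ x, (hηε τ x).trans (by linarith)⟩, ?_, rfl⟩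
    convert measure_empty (μ := (volume : Measure (Cube d)))
    refine Set.eq_empty_of_forall_notMem fun x hx => ?_
    have h1 := hx.2
    have h2 := neg_abs_le (2 * η τ x - 1)
    linarith [hηε τ x]
  have hzero : ∀ τ x, bumpSum τ ((M : ℝ) • Cube.toReal (x ∘ e)) = 0 → η τ x = 0 := by
    intro τ x h
    simp only [η, f, h, mul_zero, Real.zero_rpow hp0.ne']
  have key := le_minimaxRisk_of_hypercube (n := n) (H := distClass d β r A q K dstar) (η := η)
    (B := cubeCell e (1 / 3)) (D := cubeCell e (1 / 4)) (ε := ε) (v := (1 / M : ℝ) ^ dstar)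
    (w := (2 * (1 / 4) / M : ℝ) ^ dstar)
    (fun τ => ((hfm τ).pow_const p).const_mul C) hη0 hH
    (fun j => measurableSet_cubeCell e _ j) (fun j => measurableSet_cubeCell e _ j)
    (fun i j hij => Set.disjoint_left.2 fun x hi hj =>
      hij (cell_disjoint (by norm_num) hi hj))
    hε hε2 hηε ?_ ?_ ?_ ?_ ?_ hn
  · refine le_trans (le_of_eq ?_) key
    have hcard : ((Fintype.card (Fin dstar → Fin M) : ℕ) : ℝ≥0∞) =
        ENNReal.ofReal ((M : ℝ) ^ dstar) := by
      rw [ENNReal.ofReal_pow hM0.le]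
      simp
    have htwo : (2 : ℝ≥0∞) = ENNReal.ofReal 2 := by simp
    rw [hcard, htwo, ← ENNReal.ofReal_mul (by positivity), ← ENNReal.ofReal_mul (by positivity),
      ← ENNReal.ofReal_mul (by positivity), ← ENNReal.ofReal_div_of_pos two_pos]
    congr 1
    have hprod : (M : ℝ) ^ dstar * (2 * (1 / 4) / M) ^ dstar = (1 / 2) ^ dstar := by
      rw [← mul_pow]
      congr 1
      field_simp
      norm_num
    rw [← hprod]
    ring
  · intro τ j x hx
    have := bumpSum_eq_of_mem_core (τ := τ) hx
    by_cases hj : τ j = true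
    · rw [if_pos hj] at this ⊢
      simp only [η, f, this, mul_one, hεa]
    · rw [if_neg hj] at this ⊢
      exact hzero τ x this
  · intro τ j hj x hx
    refine hzero τ x ?_
    rw [bumpSum_eq_of_mem hx, hj]
    simp
  · intro τ j b' x hx
    have : bumpSum (Function.update τ j b') ((M : ℝ) • Cube.toReal (x ∘ e)) =
        bumpSum τ ((M : ℝ) • Cube.toReal (x ∘ e)) := by
      refine bumpSum_congr fun i hi => Function.update_of_ne ?_ _ _
      rintro rfl
      exact hx hi
    simp only [η, f, this]
  · intro j
    rw [volume_cubeCell e (by norm_num) (by norm_num)]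
    gcongr
    norm_num
  · intro j
    rw [volume_cubeCell e (by norm_num) (by norm_num)]

end LogisticMinimax

/-! ### Choice of the grid size -/

theorem theorem2p6 (dstar : ℕ) (hdstar : 1 ≤ dstar) (β r : ℝ) (hβ : 0 < β) (hr : 0 < r) (q : ℕ) :
    ∃ c₀ : ℝ, 0 < c₀ ∧
      ∀ (n d K : ℕ) (A : ℝ), 1 ≤ n → 1 ≤ d → 1 ≤ K → 0 ≤ A → A < 1 →
        dstar ≤ min d (if q = 0 then d else K) →
        (7 / (1 - A)) ^ ((dstar + β * (min 1 β) ^ q) / (β * (min 1 β) ^ q)) < (n : ℝ) →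
        ENNReal.ofReal (c₀ * (n : ℝ) ^ (-(β * (min 1 β) ^ q / (dstar + β * (min 1 β) ^ q)))) ≤
          LogisticMinimax.minimaxRisk d n (LogisticMinimax.distClass d β r A q K dstar) := by
  obtain ⟨κ, hκ, hκ1, hgrid⟩ := LogisticMinimax.exists_le_minimaxRisk_grid hdstar hβ hr q
  set s := β * (min 1 β) ^ q with hs
  have hs0 : 0 < s := mul_pos hβ (pow_pos (lt_min one_pos hβ) q)
  have hD : (1 : ℝ) ≤ dstar := by exact_mod_cast hdstar
  set S := (dstar : ℝ) + s with hS
  have hS0 : 0 < S := by positivity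
  refine ⟨κ * 3 ^ (-s) / 16 * (1 / 2) ^ dstar, by positivity, ?_⟩
  intro n d K A hn1 _ _ _ hA hdmin hn
  have hd : dstar ≤ d := hdmin.trans (min_le_left _ _)
  have hK : q ≠ 0 → dstar ≤ K := fun hq => by
    simpa [hq] using hdmin.trans (min_le_right _ _)
  have hn1' : (1 : ℝ) ≤ n := by exact_mod_cast hn1
  have hn0 : (0 : ℝ) < n := by linarith
  -- the grid size is `M ≈ 2 n ^ (1 / S)`; the factor `2` makes `n ε M ^ (-dstar)` at most `1 / 2`
  set N : ℝ := (n : ℝ) ^ (1 / S) with hN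
  have hN1 : 1 ≤ N := Real.one_le_rpow hn1' (by positivity)
  have hNs : N ^ (-s) = (n : ℝ) ^ (-(s / S)) := by
    rw [hN, ← Real.rpow_mul hn0.le]
    congr 1
    ring
  have hNS : N ^ (-S) = (n : ℝ)⁻¹ := by
    rw [hN, ← Real.rpow_mul hn0.le, ← Real.rpow_neg_one]
    congr 1
    field_simp
  have hMlow := Nat.le_ceil (2 * N)
  have hMup := Nat.ceil_lt_add_one (show 0 ≤ 2 * N by linarith)
  set M := ⌈2 * N⌉₊ with hM
  have hM0 : (0 : ℝ) < M := by linarith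
  have hM1 : 1 ≤ M := by exact_mod_cast hM0
  set ε := κ * (M : ℝ) ^ (-s) with hε
  have hεN : ε ≤ N ^ (-s) := by
    have h1 : (M : ℝ) ^ (-s) ≤ N ^ (-s) :=
      Real.rpow_le_rpow_of_nonpos (by linarith) (by linarith) (by linarith)
    calc ε ≤ 1 * N ^ (-s) := by rw [hε]; gcongr
      _ = _ := one_mul _
  have h7 : N ^ (-s) < (1 - A) / 7 := by
    have hA' : 0 < 1 - A := by linarith
    have h1 := Real.rpow_lt_rpow (by positivity) hn (show 0 < s / S by positivity)
    rw [← Real.rpow_mul (by positivity), show S / s * (s / S) = 1 by field_simp,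
      Real.rpow_one] at h1
    rw [hNs, Real.rpow_neg hn0.le]
    have h2 := (inv_lt_inv₀ (lt_trans (by positivity) h1) (by positivity)).2 h1
    rwa [inv_div] at h2
  refine le_trans (ENNReal.ofReal_le_ofReal ?_)
    (hgrid n d K M A ε hM1 hd hK rfl (by linarith) (by linarith) ?_)
  · have h1 : (3 * N) ^ (-s) ≤ (M : ℝ) ^ (-s) :=
      Real.rpow_le_rpow_of_nonpos hM0 (by linarith) (by linarith)
    rw [Real.mul_rpow (by norm_num) (by linarith), hNs] at h1
    calc κ * 3 ^ (-s) / 16 * (1 / 2) ^ dstar * (n : ℝ) ^ (-(s / S))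
        = κ * (3 ^ (-s) * (n : ℝ) ^ (-(s / S))) / 16 * (1 / 2) ^ dstar := by ring
      _ ≤ ε / 16 * (1 / 2) ^ dstar := by rw [hε]; gcongr
  · have h1 : (M : ℝ) ^ (-s) * (1 / M) ^ dstar = (M : ℝ) ^ (-S) := by
      rw [one_div, inv_pow, ← Real.rpow_natCast, ← Real.rpow_neg hM0.le, ← Real.rpow_add hM0]
      congr 1
      rw [hS]
      ring
    have h2 : (M : ℝ) ^ (-S) ≤ (2 * N) ^ (-S) :=
      Real.rpow_le_rpow_of_nonpos (by linarith) hMlow (by linarith)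
    have h3 : (2 : ℝ) ^ (-S) ≤ 1 / 2 := by
      calc (2 : ℝ) ^ (-S) ≤ 2 ^ (-1 : ℝ) :=
            Real.rpow_le_rpow_of_exponent_le (by norm_num) (by linarith)
        _ = 1 / 2 := by rw [Real.rpow_neg_one]; norm_num
    rw [Real.mul_rpow (by norm_num) (by linarith), hNS] at h2
    calc n * (ε * (1 / M : ℝ) ^ dstar) = n * (κ * (M : ℝ) ^ (-S)) := by rw [hε, ← h1]; ring
      _ ≤ n * (1 * (1 / 2 * (n : ℝ)⁻¹)) := by
        gcongr
        exact h2.trans (by gcongr)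
      _ = 1 / 2 := by field_simp
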